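/- **Theorem 3.1.** Notation. $\mathbb N=\{1,2,\dots\}$; empty sums are $0$ and empty products are $1$. Iterated logarithms: $\ln_1=\ln$, $\ln_{j+1}=\ln\circ\ln_j$. Normalized logarithms: $L_1(s)=(1-\ln s)^{-1}$, $L_{j+1}(s)=L_1(L_j(s))$ $(j\in\mathbb N)$. Iterated exponentials: $e_0=0$, $e_{j+1}=e^{e_j}$ $(j\ge 0)$. For $p\in\mathbb N$, $\alpha\in\mathbb R$ put $$A(p,\alpha)=\prod_{j=1}^p\Big(\frac{2j-1-\alpha}{2}\Big)^2,\qquad B(p,\alpha)=\frac1{4^p}\sum_{k=1}^p\ \prod_{\substack{1\le j\le p\\ j\ne k}}(2j-1-\alpha)^2,$$ and let $c_i(p,\alpha)$, $0\le i\le 2p$, be the coefficients of the polynomial $$\sum_{i=0}^{2p}c_i(p,\alpha)\lambda^i=\prod_{j=1}^p\Big(\lambda^2-\frac{(2j-1-\alpha)^2}{4}\Big).$$ $C_0^\infty((a,b))$ denotes the complex-valued $C^\infty$ functions with compact support in the open interval $(a,b)$. Let $\ell,m,N\in\mathbb N$ with $1\le\ell\le m$, $\alpha\in\mathbb R$, and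 $\rho,\gamma,\tau\in(0,\infty)$. Then the following hold. (i) If $\rho\ge e_N\gamma$, then for all $f\in C_0^\infty((\rho,\infty))$, $$\begin{aligned}\int_\rho^\infty x^\alpha|f^{(m)}(x)|^2dx\ \ge\ & A(\ell,\alpha)\int_\rho^\infty x^{\alpha-2\ell}|f^{(m-\ell)}(x)|^2dx\\ &+B(\ell,\alpha)\sum_{k=1}^N\int_\rho^\infty x^{\alpha-2\ell}\prod_{p=1}^k[\ln_p(x/\gamma)]^{-2}\,|f^{(m-\ell)}(x)|^2dx\\ &+\sum_{j=2}^\ell|c_{2j}(\ell,\alpha)|A(j,0)\int_\rho^\infty x^{\alpha-2\ell}[\ln(x/\gamma)]^{-2j}|f^{(m-\ell)}(x)|^2dx\\ &+\sum_{j=2}^\ell|c_{2j}(\ell,\alpha)|B(j,0)\sum_{k=1}^{N-1}\int_\rho^\infty x^{\alpha-2\ell}[\ln(x/\gamma)]^{-2j}\prod_{p=1}^k[\ln_{p+1}(x/\gamma)]^{-2}\,|f^{(m-\ell)}(x)|^2dx.\end{aligned}$$ (ii) If $\rho\ge\tau$, then for all $f\in C_0^\infty((\rho,\infty))$, $$\begin{aligned}\int_\rho^\infty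 x^\alpha|f^{(m)}(x)|^2dx\ \ge\ & A(\ell,\alpha)\int_\rho^\infty x^{\alpha-2\ell}|f^{(m-\ell)}(x)|^2dx\\ &+B(\ell,\alpha)\sum_{k=1}^N\int_\rho^\infty x^{\alpha-2\ell}\prod_{p=1}^k[L_p(\tau/x)]^{2}\,|f^{(m-\ell)}(x)|^2dx\\ &+\sum_{j=2}^\ell|c_{2j}(\ell,\alpha)|A(j,0)\int_\rho^\infty x^{\alpha-2\ell}[L_1(\tau/x)]^{2j}|f^{(m-\ell)}(x)|^2dx\\ &+\sum_{j=2}^\ell|c_{2j}(\ell,\alpha)|B(j,0)\sum_{k=1}^{N-1}\int_\rho^\infty x^{\alpha-2\ell}[L_1(\tau/x)]^{2j}\prod_{p=1}^k[L_{p+1}(\tau/x)]^{2}\,|f^{(m-\ell)}(x)|^2dx.\end{aligned}$$ (iii) If $\gamma\ge e_N\rho$, then for all $f\in C_0^\infty((0,\rho))$, $$\begin{aligned}\int_0^\rho x^\alpha|f^{(m)}(x)|^2dx\ \ge\ & A(\ell,\alpha)\int_0^\rho x^{\alpha-2\ell}|f^{(m-\ell)}(x)|^2dx\\ &+B(\ell,\alpha)\sum_{k=1}^N\int_0^\rho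 x^{\alpha-2\ell}\prod_{p=1}^k[\ln_p(\gamma/x)]^{-2}\,|f^{(m-\ell)}(x)|^2dx\\ &+\sum_{j=2}^\ell|c_{2j}(\ell,\alpha)|A(j,0)\int_0^\rho x^{\alpha-2\ell}[\ln(\gamma/x)]^{-2j}|f^{(m-\ell)}(x)|^2dx\\ &+\sum_{j=2}^\ell|c_{2j}(\ell,\alpha)|B(j,0)\sum_{k=1}^{N-1}\int_0^\rho x^{\alpha-2\ell}[\ln(\gamma/x)]^{-2j}\prod_{p=1}^k[\ln_{p+1}(\gamma/x)]^{-2}\,|f^{(m-\ell)}(x)|^2dx.\end{aligned}$$ (iv) If $\tau\ge\rho$, then for all $f\in C_0^\infty((0,\rho))$, $$\begin{aligned}\int_0^\rho x^\alpha|f^{(m)}(x)|^2dx\ \ge\ & A(\ell,\alpha)\int_0^\rho x^{\alpha-2\ell}|f^{(m-\ell)}(x)|^2dx\\ &+B(\ell,\alpha)\sum_{k=1}^N\int_0^\rho x^{\alpha-2\ell}\prod_{p=1}^k[L_p(x/\tau)]^{2}\,|f^{(m-\ell)}(x)|^2dx\\ &+\sum_{j=2}^\ell|c_{2j}(\ell,\alpha)|A(j,0)\int_0^\rho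 x^{\alpha-2\ell}[L_1(x/\tau)]^{2j}|f^{(m-\ell)}(x)|^2dx\\ &+\sum_{j=2}^\ell|c_{2j}(\ell,\alpha)|B(j,0)\sum_{k=1}^{N-1}\int_0^\rho x^{\alpha-2\ell}[L_1(x/\tau)]^{2j}\prod_{p=1}^k[L_{p+1}(x/\tau)]^{2}\,|f^{(m-\ell)}(x)|^2dx.\end{aligned}$$ (v) Each of the inequalities in (i)–(iv) is strict if $f\not\equiv0$ on $(\rho,\infty)$, respectively on $(0,\rho)$. (vi) $A(\ell,\alpha)=0$ if and only if $\alpha\in\{2j-1\}_{1\le j\le\ell}$; in these exceptional cases the first terms on the right-hand sides in (i)–(iv), those containing $A(\ell,\alpha)$, are to be deleted, and the resulting inequalities hold, strictly if $f\not\equiv0$. -/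

import Mathlib

open scoped ContDiff

namespace BHR

/-- Iterated logarithms: `iterLog 1 = ln` and `iterLog (j + 1) = ln ∘ iterLog j` for `j ≥ 1`
(the index `0` is the identity). -/
noncomputable def iterLog : ℕ → ℝ → ℝ
  | 0, x => x
  | j + 1, x => Real.log (iterLog j x)

/-- Normalized iterated logarithms: `normLog 1 s = (1 - ln s)⁻¹` and
`normLog (j + 1) s = normLog 1 (normLog j s)` for `j ≥ 1` (the index `0` is the identity). -/
noncomputable def normLog : ℕ → ℝ → ℝ
  | 0, s => s
  | j + 1, s => (1 - Real.log (normLog j s))⁻¹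

/-- Iterated exponentials: `e_0 = 0`, `e_{j+1} = exp e_j`; so `e_1 = 1`, `e_2 = e`. -/
noncomputable def iterExp : ℕ → ℝ
  | 0 => 0
  | j + 1 => Real.exp (iterExp j)

/-- `A(p, α) = ∏_{j=1}^{p} ((2j - 1 - α)/2)²`. -/
noncomputable def A (p : ℕ) (α : ℝ) : ℝ :=
  ∏ j ∈ Finset.Icc 1 p, ((2 * (j : ℝ) - 1 - α) / 2) ^ 2

/-- `B(p, α) = 4^{-p} ∑_{k=1}^{p} ∏_{1 ≤ j ≤ p, j ≠ k} (2j - 1 - α)²`. -/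
noncomputable def B (p : ℕ) (α : ℝ) : ℝ :=
  1 / 4 ^ p * ∑ k ∈ Finset.Icc 1 p, ∏ j ∈ (Finset.Icc 1 p).erase k, (2 * (j : ℝ) - 1 - α) ^ 2

/-- `P_{p,α}(λ) = ∏_{j=1}^{p} (λ² - (2j - 1 - α)²/4)`. -/
noncomputable def P (p : ℕ) (α : ℝ) : Polynomial ℝ :=
  ∏ j ∈ Finset.Icc 1 p, (Polynomial.X ^ 2 - Polynomial.C ((2 * (j : ℝ) - 1 - α) ^ 2 / 4))

/-- `c_i(p, α)`, the coefficient of `λ^i` in `P_{p,α}(λ)`. -/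
noncomputable def c (i p : ℕ) (α : ℝ) : ℝ := (P p α).coeff i

/-- `f ∈ C_0^∞(S)` for an open set `S ⊆ ℝ`: complex-valued, smooth, with compact support
contained in `S` (functions on `S` are identified with their extension by zero). -/
structure IsTestFunction (S : Set ℝ) (f : ℝ → ℂ) : Prop where
  smooth : ContDiff ℝ ∞ f
  hasCompactSupport : HasCompactSupport f
  tsupport_subset : tsupport f ⊆ S

/-- `∫_S x^β |f^{(n)}(x)|² dx`. -/
noncomputable def powerIntegral (S : Set ℝ) (β : ℝ) (n : ℕ) (f : ℝ → ℂ) : ℝ :=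
  ∫ x in S, x ^ β * ‖iteratedDeriv n f x‖ ^ 2

/-- The logarithmic refinement terms, for a family of logarithmic weights `u p x` (which will be
`[ln_p(x/γ)]⁻¹`, `L_p(τ/x)`, `[ln_p(γ/x)]⁻¹` or `L_p(x/τ)`), `p = 1, 2, …`:
`B(ℓ,α) ∑_{k=1}^{N} ∫_S x^{α-2ℓ} ∏_{p=1}^{k} u_p(x)² |f^{(m-ℓ)}(x)|² dx`
`+ ∑_{j=2}^{ℓ} |c_{2j}(ℓ,α)| A(j,0) ∫_S x^{α-2ℓ} u_1(x)^{2j} |f^{(m-ℓ)}(x)|² dx`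
`+ ∑_{j=2}^{ℓ} |c_{2j}(ℓ,α)| B(j,0) ∑_{k=1}^{N-1} ∫_S x^{α-2ℓ} u_1(x)^{2j}`
`  ∏_{p=1}^{k} u_{p+1}(x)² |f^{(m-ℓ)}(x)|² dx`. -/
noncomputable def logTerms (S : Set ℝ) (u : ℕ → ℝ → ℝ) (ℓ m N : ℕ) (α : ℝ) (f : ℝ → ℂ) : ℝ :=
  (B ℓ α * ∑ k ∈ Finset.Icc 1 N,
      (∫ x in S, x ^ (α - 2 * (ℓ : ℝ)) * (∏ p ∈ Finset.Icc 1 k, u p x ^ 2)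
        * ‖iteratedDeriv (m - ℓ) f x‖ ^ 2))
  + (∑ j ∈ Finset.Icc 2 ℓ, |c (2 * j) ℓ α| * A j 0 *
      (∫ x in S, x ^ (α - 2 * (ℓ : ℝ)) * u 1 x ^ (2 * j) * ‖iteratedDeriv (m - ℓ) f x‖ ^ 2))
  + (∑ j ∈ Finset.Icc 2 ℓ, |c (2 * j) ℓ α| * B j 0 * ∑ k ∈ Finset.Icc 1 (N - 1),
      (∫ x in S, x ^ (α - 2 * (ℓ : ℝ)) * u 1 x ^ (2 * j)
        * (∏ p ∈ Finset.Icc 1 k, u (p + 1) x ^ 2) * ‖iteratedDeriv (m - ℓ) f x‖ ^ 2))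

/-- For all `f ∈ C_0^∞(S)`, the inequality
`∫_S x^α |f^{(m)}|² ≥ A(ℓ,α) ∫_S x^{α-2ℓ} |f^{(m-ℓ)}|² + logarithmic terms`,
and its strictness when `f` does not vanish identically on `S`. -/
def RefinedInequality (S : Set ℝ) (u : ℕ → ℝ → ℝ) (ℓ m N : ℕ) (α : ℝ) : Prop :=
  ∀ f : ℝ → ℂ, IsTestFunction S f →
    powerIntegral S α m f ≥
      A ℓ α * powerIntegral S (α - 2 * (ℓ : ℝ)) (m - ℓ) f + logTerms S u ℓ m N α f ∧
    ((∃ x ∈ S, f x ≠ 0) → powerIntegral S α m f >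
      A ℓ α * powerIntegral S (α - 2 * (ℓ : ℝ)) (m - ℓ) f + logTerms S u ℓ m N α f)

/-- The same inequality, with strictness, and with the term containing `A(ℓ,α)` deleted. -/
def RefinedInequalityWithoutA (S : Set ℝ) (u : ℕ → ℝ → ℝ) (ℓ m N : ℕ) (α : ℝ) : Prop :=
  ∀ f : ℝ → ℂ, IsTestFunction S f →
    powerIntegral S α m f ≥ logTerms S u ℓ m N α f ∧
    ((∃ x ∈ S, f x ≠ 0) → powerIntegral S α m f > logTerms S u ℓ m N α f)

end BHR

/-!
Everything follows from one logarithmic substitution and an induction on the number of logarithms.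

Put `g = f^(m-ℓ)` and `x = exp (b + σ t)` with `σ = ±1`, and let `w(t) = x^(-s) g(x)` with
`s = (2ℓ - 1 - α)/2`. Then `x^(α-2ℓ) |g|² dx` becomes `|w|² dt`, and each differentiation becomes
a factor `σ d/dt + a` with constant `a` (`logSubst_deriv`). Since
`∫ |(σ d/dt + a) h|² = ∫ |h'|² + a² ∫ |h|²` for compactly supported `h`, this gives
`∫ x^α |g^(ℓ)|² dx = ∑ⱼ rⱼ ∫ |w^(j)|² dt`, where the `rⱼ` are the coefficients of
`∏ₖ (X + ((2k - 1 - α)/2)²)` (`setIntegral_rpow_mul_norm_sq_iteratedDeriv`). They satisfy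
`rⱼ = |c_{2j}(ℓ,α)|`, `r₀ = A(ℓ,α)`, `r₁ = 4 B(ℓ,α)` and `r_ℓ = 1`.

The term `j = 0` is the one containing `A(ℓ,α)`. To each `∫ |w^(j)|²` with `j ≥ 1` one applies the
inequality with `α = 0`, order `j` and one logarithm fewer, of which only the terms with `A(j,0)`
and `B(j,0)` are kept (`HardyRefinement`): as `A(1,0) = B(1,0) = 1/4`, the order `j = 1` yields
precisely the terms with `B(ℓ,α)`, and the orders `j ≥ 2` yield the remaining ones (`logTerms_eq`).
This is the inductive step `HardyRefinement.refinedInequality`. The induction starts at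
`hardyRefinement_zero`, which keeps only the term `j = 0` of the energy, and strictness is carried
along by the top coefficient `r_ℓ = 1`.

The four cases differ only in the substitution: `t = log (x/γ)`, `t = 1 + log (x/τ)` on the exterior
interval, and `t = log (γ/x)`, `t = 1 + log (τ/x)` on the interior one. In each of them the new
variable ranges over an exterior interval, `t > e_{N-1}` or `t > 1`, and the weights `u_{p+1}(x)`
are the weights of index `p` in the variable `t`.
-/

namespace BHR

open MeasureTheory Polynomial

/-! ### Test functions -/

namespace IsTestFunction

variable {S : Set ℝ} {g : ℝ → ℂ}

theorem deriv (hg : IsTestFunction S g) : IsTestFunction S (deriv g) :=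
  ⟨(contDiff_infty_iff_deriv.mp hg.smooth).2, hg.hasCompactSupport.deriv,
    tsupport_deriv_subset.trans hg.tsupport_subset⟩

theorem iteratedDeriv (hg : IsTestFunction S g) (n : ℕ) :
    IsTestFunction S (iteratedDeriv n g) := by
  induction n with
  | zero => simpa using hg
  | succ n ih => rw [iteratedDeriv_succ]; exact ih.deriv

theorem differentiable (hg : IsTestFunction S g) : Differentiable ℝ g :=
  hg.smooth.differentiable (by simp)

theorem eq_zero_of_notMem (hg : IsTestFunction S g) {x : ℝ} (hx : x ∉ S) : g x = 0 :=
  image_eq_zero_of_notMem_tsupport fun h => hx (hg.tsupport_subset h)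

theorem integrable_norm_sq (hg : IsTestFunction S g) : Integrable fun x => ‖g x‖ ^ 2 := by
  have hc : Continuous fun x => ‖g x‖ ^ 2 := hg.smooth.continuous.norm.pow 2
  exact hc.integrable_of_hasCompactSupport
    (hg.hasCompactSupport.mono fun x hx h => hx (by simp [h]))

theorem integral_norm_sq_pos (hg : IsTestFunction S g) (h : ∃ x, g x ≠ 0) :
    0 < ∫ x, ‖g x‖ ^ 2 := by
  obtain ⟨x, hx⟩ := h
  exact (hg.smooth.continuous.norm.pow 2).integral_pos_of_hasCompactSupport_nonneg_nonzero
    (hg.hasCompactSupport.comp_left (g := fun z : ℂ => ‖z‖ ^ 2) (by simp))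
    (fun x => by positivity) (x := x) (by simpa using hx)

/-- A compactly supported function with identically vanishing derivative is zero. -/
theorem exists_deriv_ne_zero (hg : IsTestFunction S g) (h : ∃ x, g x ≠ 0) :
    ∃ x, _root_.deriv g x ≠ 0 := by
  by_contra! hd
  obtain ⟨x, hx⟩ := h
  obtain ⟨y, hy⟩ := (Set.ne_univ_iff_exists_notMem _).mp hg.hasCompactSupport.isCompact.ne_univ
  exact hx ((is_const_of_deriv_eq_zero hg.differentiable hd x y).trans
    (image_eq_zero_of_notMem_tsupport hy))

theorem exists_iteratedDeriv_ne_zero (hg : IsTestFunction S g) (h : ∃ x, g x ≠ 0) (n : ℕ) :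
    ∃ x, _root_.iteratedDeriv n g x ≠ 0 := by
  induction n with
  | zero => simpa using h
  | succ n ih => rw [iteratedDeriv_succ]; exact (hg.iteratedDeriv n).exists_deriv_ne_zero ih

theorem integrable_inner_deriv (hg : IsTestFunction S g) :
    Integrable fun x => inner ℝ (g x) (_root_.deriv g x) :=
  (hg.smooth.continuous.inner hg.deriv.smooth.continuous).integrable_of_hasCompactSupport
    (hg.hasCompactSupport.mono fun x hx h => hx (by simp [h]))

/-- The cross term `2 Re (ḡ g')` is the derivative of `|g|²`, so it integrates to zero. -/
theorem integral_inner_deriv (hg : IsTestFunction S g) :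
    ∫ x, inner ℝ (g x) (_root_.deriv g x) = 0 := by
  have hd (x : ℝ) : HasDerivAt (fun y => ‖g y‖ ^ 2) (2 * inner ℝ (g x) (_root_.deriv g x)) x :=
    (hg.differentiable x).hasDerivAt.norm_sq
  have := integral_eq_zero_of_hasDerivAt_of_integrable hd (hg.integrable_inner_deriv.const_mul 2)
    hg.integrable_norm_sq
  rw [integral_const_mul] at this
  linarith

end IsTestFunction

/-! ### First-order operators with constant coefficients -/

/-- The operator `σ d/dt + a`. -/
noncomputable def shiftedDeriv (σ a : ℝ) (g : ℝ → ℂ) (t : ℝ) : ℂ := σ • deriv g t + a • g t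

theorem IsTestFunction.shiftedDeriv {S : Set ℝ} {g : ℝ → ℂ} (hg : IsTestFunction S g) (σ a : ℝ) :
    IsTestFunction S (shiftedDeriv σ a g) := by
  refine ⟨(hg.deriv.smooth.const_smul σ).add (hg.smooth.const_smul a), ?_, ?_⟩
  · refine hg.hasCompactSupport.mono' fun x hx => ?_
    by_contra h
    exact hx (by simp [BHR.shiftedDeriv, image_eq_zero_of_notMem_tsupport h,
      deriv_of_notMem_tsupport h])
  · refine subset_trans (closure_minimal (fun x hx => ?_) (isClosed_tsupport g)) hg.tsupport_subset
    by_contra h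
    exact hx (by simp [BHR.shiftedDeriv, image_eq_zero_of_notMem_tsupport h,
      deriv_of_notMem_tsupport h])

theorem iteratedDeriv_shiftedDeriv {S : Set ℝ} {g : ℝ → ℂ} (hg : IsTestFunction S g) (σ a : ℝ)
    (n : ℕ) : iteratedDeriv n (shiftedDeriv σ a g) = shiftedDeriv σ a (iteratedDeriv n g) := by
  induction n with
  | zero => simp
  | succ n ih =>
    have h := hg.iteratedDeriv n
    rw [iteratedDeriv_succ, ih, iteratedDeriv_succ]
    ext t
    exact (((h.deriv.differentiable t).hasDerivAt.const_smul σ).add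
      ((h.differentiable t).hasDerivAt.const_smul a)).deriv

theorem integral_norm_sq_shiftedDeriv {S : Set ℝ} {g : ℝ → ℂ} (hg : IsTestFunction S g)
    {σ : ℝ} (hσ : σ ^ 2 = 1) (a : ℝ) :
    ∫ t, ‖shiftedDeriv σ a g t‖ ^ 2 = (∫ t, ‖deriv g t‖ ^ 2) + a ^ 2 * ∫ t, ‖g t‖ ^ 2 := by
  have h (t : ℝ) : ‖shiftedDeriv σ a g t‖ ^ 2 =
      ‖deriv g t‖ ^ 2 + a ^ 2 * ‖g t‖ ^ 2 + 2 * σ * a * inner ℝ (g t) (deriv g t) := by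
    rw [shiftedDeriv, norm_add_sq_real, norm_smul, norm_smul, mul_pow, mul_pow, Real.norm_eq_abs,
      Real.norm_eq_abs, sq_abs, sq_abs, hσ, inner_smul_left, inner_smul_right, real_inner_comm]
    simp only [conj_trivial]
    ring
  simp_rw [h]
  rw [integral_add (hg.deriv.integrable_norm_sq.fun_add (hg.integrable_norm_sq.const_mul _))
      (hg.integrable_inner_deriv.const_mul _), integral_add hg.deriv.integrable_norm_sq
      (hg.integrable_norm_sq.const_mul _), integral_const_mul, integral_const_mul,
    hg.integral_inner_deriv, mul_zero, add_zero]

/-! ### The logarithmic substitution -/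

/-- The logarithmic (Emden–Fowler) substitution `x = exp (b + σ t)`, where `σ = ±1`, combined
with multiplication by `x ^ (-s)`. -/
noncomputable def logSubst (σ b s : ℝ) (g : ℝ → ℂ) (t : ℝ) : ℂ :=
  Real.exp (-s * (b + σ * t)) • g (Real.exp (b + σ * t))

/-- The inverse change of variable `t = σ (log x - b)`. -/
noncomputable def logCoord (σ b x : ℝ) : ℝ := σ * (Real.log x - b)

section

variable {σ b : ℝ}

theorem logCoord_exp (hσ : σ ^ 2 = 1) (t : ℝ) : logCoord σ b (Real.exp (b + σ * t)) = t := by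
  rw [logCoord, Real.log_exp]
  linear_combination t * hσ

theorem exp_logCoord (hσ : σ ^ 2 = 1) {x : ℝ} (hx : 0 < x) :
    Real.exp (b + σ * logCoord σ b x) = x := by
  rw [logCoord, show b + σ * (σ * (Real.log x - b)) = Real.log x by
    linear_combination (Real.log x - b) * hσ, Real.exp_log hx]

theorem logSubst_ne_zero_iff {s t : ℝ} {g : ℝ → ℂ} :
    logSubst σ b s g t ≠ 0 ↔ g (Real.exp (b + σ * t)) ≠ 0 := by
  simp [logSubst]

theorem IsTestFunction.logSubst {S T : Set ℝ} {g : ℝ → ℂ} (hg : IsTestFunction S g)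
    (hσ : σ ^ 2 = 1) (hS : S ⊆ Set.Ioi 0) (hT : Set.MapsTo (logCoord σ b) S T) (s : ℝ) :
    IsTestFunction T (logSubst σ b s g) := by
  have hK : IsCompact (logCoord σ b '' tsupport g) := by
    refine hg.hasCompactSupport.isCompact.image_of_continuousOn fun x hx => ?_
    have hx0 : x ≠ 0 := ne_of_gt (hS (hg.tsupport_subset hx))
    exact (((Real.continuousAt_log hx0).sub continuousAt_const).const_mul σ).continuousWithinAt
  have hsub : Function.support (BHR.logSubst σ b s g) ⊆ logCoord σ b '' tsupport g := fun t ht =>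
    ⟨_, subset_tsupport g (logSubst_ne_zero_iff.mp ht), logCoord_exp hσ t⟩
  refine ⟨?_, HasCompactSupport.of_support_subset_isCompact hK hsub,
    (closure_minimal hsub hK.isClosed).trans ?_⟩
  · have h := hg.smooth
    unfold BHR.logSubst
    fun_prop
  · exact (hT.mono_left hg.tsupport_subset).image_subset

theorem exists_logSubst_ne_zero (hσ : σ ^ 2 = 1) {S : Set ℝ} {g : ℝ → ℂ}
    (hg : IsTestFunction S g) (hS : S ⊆ Set.Ioi 0) (h : ∃ x, g x ≠ 0) (s : ℝ) :
    ∃ t, logSubst σ b s g t ≠ 0 := by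
  obtain ⟨x, hx⟩ := h
  have hxS : x ∈ S := by
    by_contra hn
    exact hx (hg.eq_zero_of_notMem hn)
  exact ⟨logCoord σ b x, logSubst_ne_zero_iff.mpr (by rwa [exp_logCoord hσ (hS hxS)])⟩

/-- The substitution turns differentiation into a first-order operator with constant
coefficients. -/
theorem logSubst_deriv (hσ : σ ^ 2 = 1) {g : ℝ → ℂ} (hg : Differentiable ℝ g) (s : ℝ) :
    logSubst σ b (s - 1) (deriv g) = shiftedDeriv σ s (logSubst σ b s g) := by
  ext t
  have hy : HasDerivAt (fun t : ℝ => b + σ * t) σ t := by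
    simpa using ((hasDerivAt_id t).const_mul σ).const_add b
  have hD : HasDerivAt (logSubst σ b s g)
      (Real.exp (-s * (b + σ * t)) • ((Real.exp (b + σ * t) * σ) •
        deriv g (Real.exp (b + σ * t))) +
      (Real.exp (-s * (b + σ * t)) * (-s * σ)) • g (Real.exp (b + σ * t))) t :=
    ((hy.const_mul (-s)).exp).smul ((hg _).hasDerivAt.scomp t hy.exp)
  rw [shiftedDeriv, hD.deriv, logSubst, logSubst,
    show -(s - 1) * (b + σ * t) = -s * (b + σ * t) + (b + σ * t) by ring, Real.exp_add]
  simp only [smul_add, smul_smul]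
  rw [add_assoc, ← add_smul]
  rw [show σ * (Real.exp (-s * (b + σ * t)) * (-s * σ)) + s * Real.exp (-s * (b + σ * t)) = 0 by
    linear_combination -s * Real.exp (-s * (b + σ * t)) * hσ, zero_smul, add_zero]
  congr 1
  linear_combination -(Real.exp (-s * (b + σ * t)) * Real.exp (b + σ * t)) * hσ

/-- Change of variables. No integrability is needed, so the weight `V` may be arbitrary. -/
theorem setIntegral_eq_setIntegral_logSubst (hσ : σ ^ 2 = 1) {S T : Set ℝ}
    {g : ℝ → ℂ} (hg : IsTestFunction S g) (hS : S ⊆ Set.Ioi 0) (hSm : MeasurableSet S)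
    (hT : Set.MapsTo (logCoord σ b) S T) {s β : ℝ} (hβ : β = -2 * s - 1) {W V : ℝ → ℝ}
    (hW : ∀ x ∈ S, W x = V (logCoord σ b x)) :
    ∫ x in S, x ^ β * W x * ‖g x‖ ^ 2 = ∫ t in T, V t * ‖logSubst σ b s g t‖ ^ 2 := by
  have hw := hg.logSubst hσ hS hT s
  have himage : (fun t : ℝ => Real.exp (b + σ * t)) '' Set.univ = Set.Ioi 0 := by
    ext x
    constructor
    · rintro ⟨t, -, rfl⟩
      exact Real.exp_pos _
    · exact fun hx => ⟨logCoord σ b x, trivial, exp_logCoord hσ hx⟩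
  have hder (t : ℝ) : HasDerivAt (fun t : ℝ => Real.exp (b + σ * t))
      (Real.exp (b + σ * t) * σ) t := by
    simpa using (((hasDerivAt_id t).const_mul σ).const_add b).exp
  have hinj : Function.Injective fun t : ℝ => Real.exp (b + σ * t) := fun t u htu => by
    rw [← logCoord_exp hσ (b := b) t, ← logCoord_exp hσ (b := b) u]
    exact congrArg _ htu
  have hσ' : |σ| = 1 := by rw [← sq_eq_sq₀ (abs_nonneg σ) zero_le_one, sq_abs, hσ, one_pow]
  calc ∫ x in S, x ^ β * W x * ‖g x‖ ^ 2
      = ∫ x in S, x ^ β * V (logCoord σ b x) * ‖g x‖ ^ 2 :=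
        setIntegral_congr_fun hSm fun x hx => by simp only [hW x hx]
    _ = ∫ x in Set.Ioi 0, x ^ β * V (logCoord σ b x) * ‖g x‖ ^ 2 :=
        (setIntegral_eq_of_subset_of_forall_sdiff_eq_zero measurableSet_Ioi hS fun x hx => by
          simp [hg.eq_zero_of_notMem hx.2]).symm
    _ = ∫ t, V t * ‖logSubst σ b s g t‖ ^ 2 := by
        rw [← himage, integral_image_eq_integral_abs_deriv_smul MeasurableSet.univ
          (fun t _ => (hder t).hasDerivWithinAt) hinj.injOn, setIntegral_univ]
        refine integral_congr_ae (Filter.Eventually.of_forall fun t => ?_)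
        simp only [logCoord_exp hσ, logSubst, norm_smul, abs_mul, hσ', mul_one, Real.abs_exp,
          Real.norm_eq_abs, smul_eq_mul, mul_pow]
        rw [← Real.exp_mul, ← Real.exp_nat_mul, hβ]
        have : Real.exp (b + σ * t) * Real.exp ((b + σ * t) * (-2 * s - 1)) =
            Real.exp ((2 : ℕ) * (-s * (b + σ * t))) := by
          rw [← Real.exp_add]; congr 1; push_cast; ring
        rw [← this]; ring
    _ = ∫ t in T, V t * ‖logSubst σ b s g t‖ ^ 2 :=
        (setIntegral_eq_integral_of_forall_compl_eq_zero fun t ht => by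
          simp [hw.eq_zero_of_notMem ht]).symm

end

/-! ### The energy identity -/

/-- The linear functional on polynomials sending `X ^ i` to `I i`. -/
noncomputable def momentFunctional (I : ℕ → ℝ) : ℝ[X] →ₗ[ℝ] ℝ :=
  Polynomial.lsum fun i => I i • LinearMap.id

theorem momentFunctional_monomial (I : ℕ → ℝ) (n : ℕ) (r : ℝ) :
    momentFunctional I (monomial n r) = I n * r := by
  simp [momentFunctional, Polynomial.lsum_apply, Polynomial.sum_monomial_index]

theorem momentFunctional_X_add_C_mul (I : ℕ → ℝ) (a : ℝ) (p : ℝ[X]) :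
    momentFunctional I ((X + C a) * p) =
      momentFunctional (fun i => I (i + 1)) p + a * momentFunctional I p := by
  induction p using Polynomial.induction_on' with
  | add p q hp hq => simp only [mul_add, map_add, hp, hq]; ring
  | monomial n r =>
    rw [add_mul, X_mul_monomial, C_mul_monomial, map_add]
    simp only [momentFunctional_monomial]
    ring

theorem momentFunctional_eq_sum (I : ℕ → ℝ) {p : ℝ[X]} {n : ℕ} (hn : p.natDegree < n) :
    momentFunctional I p = ∑ i ∈ Finset.range n, p.coeff i * I i := by
  rw [momentFunctional, Polynomial.lsum_apply, sum_over_range' _ (by simp) n hn]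
  simp [mul_comm]

/-- `∫ |∏ₖ (σ d/dt + aₖ) w|² = ∫ w̄ ∏ₖ (-d²/dt² + aₖ²) w` in its polynomial form; the
factors, with `aₖ = s - k`, come from `n` derivatives through the logarithmic substitution. -/
theorem integral_norm_sq_iteratedDeriv_logSubst {σ b : ℝ} (hσ : σ ^ 2 = 1) {S : Set ℝ}
    {g : ℝ → ℂ} (hg : IsTestFunction S g) (hS : S ⊆ Set.Ioi 0) (s : ℝ) (n j : ℕ) :
    ∫ t, ‖iteratedDeriv j (logSubst σ b (s - n) (iteratedDeriv n g)) t‖ ^ 2 =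
      momentFunctional (fun i => ∫ t, ‖iteratedDeriv (j + i) (logSubst σ b s g) t‖ ^ 2)
        (∏ i ∈ Finset.range n, (X + C ((s - i) ^ 2))) := by
  induction n generalizing j with
  | zero =>
    rw [Finset.prod_range_zero, ← monomial_zero_one, momentFunctional_monomial]
    simp
  | succ n ih =>
    have hh := (hg.iteratedDeriv n).logSubst hσ hS (Set.mapsTo_univ (logCoord σ b) S) (s - n)
    rw [Finset.prod_range_succ, mul_comm, momentFunctional_X_add_C_mul, iteratedDeriv_succ,
      Nat.cast_succ, ← sub_sub, logSubst_deriv hσ (hg.iteratedDeriv n).differentiable,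
      iteratedDeriv_shiftedDeriv hh, integral_norm_sq_shiftedDeriv (hh.iteratedDeriv j) hσ,
      ← iteratedDeriv_succ, ih, ih]
    simp only [add_assoc, add_comm 1]

/-! ### The coefficients -/

theorem A_nonneg (p : ℕ) (α : ℝ) : 0 ≤ A p α := Finset.prod_nonneg fun _ _ => sq_nonneg _

theorem B_nonneg (p : ℕ) (α : ℝ) : 0 ≤ B p α :=
  mul_nonneg (by positivity) <| Finset.sum_nonneg fun _ _ =>
    Finset.prod_nonneg fun _ _ => sq_nonneg _

theorem A_eq_zero_iff {p : ℕ} {α : ℝ} :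
    A p α = 0 ↔ ∃ j ∈ Finset.Icc 1 p, α = 2 * (j : ℝ) - 1 := by
  rw [A, Finset.prod_eq_zero_iff]
  refine exists_congr fun j => and_congr_right fun _ => ?_
  rw [sq_eq_zero_iff, div_eq_zero_iff, or_iff_left two_ne_zero, sub_eq_zero, eq_comm]

/-- `∏ⱼ (X + ((2j - 1 - α)/2)²)`. Its value at `-D²` is the constant-coefficient operator that
corresponds to the energy of `p` derivatives; up to sign, its coefficients are those of `P p α`
of even index. -/
noncomputable def energyPoly (p : ℕ) (α : ℝ) : ℝ[X] :=
  ∏ j ∈ Finset.Icc 1 p, (X + C (((2 * (j : ℝ) - 1 - α) / 2) ^ 2))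

theorem energyPoly_succ (p : ℕ) (α : ℝ) : energyPoly (p + 1) α =
    energyPoly p α * (X + C (((2 * ((p + 1 : ℕ) : ℝ) - 1 - α) / 2) ^ 2)) :=
  Finset.prod_Icc_succ_top (by lia) _

theorem monic_energyPoly (p : ℕ) (α : ℝ) : (energyPoly p α).Monic :=
  monic_prod_of_monic _ _ fun _ _ => monic_X_add_C _

theorem natDegree_energyPoly (p : ℕ) (α : ℝ) : (energyPoly p α).natDegree = p := by
  rw [energyPoly, natDegree_prod_of_monic _ _ fun _ _ => monic_X_add_C _]
  simp only [natDegree_X_add_C, Finset.sum_const, Nat.card_Icc, smul_eq_mul]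
  lia

theorem coeff_energyPoly_self (p : ℕ) (α : ℝ) : (energyPoly p α).coeff p = 1 := by
  simpa [natDegree_energyPoly] using (monic_energyPoly p α).coeff_natDegree

theorem coeff_energyPoly_zero (p : ℕ) (α : ℝ) : (energyPoly p α).coeff 0 = A p α := by
  rw [coeff_zero_eq_eval_zero, energyPoly, eval_prod]
  simp [A]

theorem coeff_energyPoly_one (p : ℕ) (α : ℝ) : (energyPoly p α).coeff 1 = 4 * B p α := by
  have h : (energyPoly p α).coeff 1 = (derivative (energyPoly p α)).eval 0 := by
    rw [← coeff_zero_eq_eval_zero, coeff_derivative]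
    simp
  rw [h, energyPoly, derivative_prod_finset, B, eval_finsetSum, ← mul_assoc, Finset.mul_sum]
  refine Finset.sum_congr rfl fun k hk => ?_
  have hpow : (4 : ℝ) ^ p = 4 ^ ((Finset.Icc 1 p).erase k).card * 4 := by
    rw [← pow_succ, Finset.card_erase_add_one hk]; simp
  simp only [eval_prod, derivative_X_add_C, mul_one, eval_add, eval_X, eval_C,
    zero_add, div_pow, Finset.prod_div_distrib, Finset.prod_const]
  rw [hpow, show (2 : ℝ) ^ 2 = 4 by norm_num]
  field_simp

theorem coeff_energyPoly_nonneg (p : ℕ) (α : ℝ) (i : ℕ) : 0 ≤ (energyPoly p α).coeff i := by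
  induction p generalizing i with
  | zero => simp only [energyPoly]; simp [coeff_one]; split_ifs <;> norm_num
  | succ p ih =>
    rw [energyPoly_succ, mul_add, coeff_add, coeff_mul_C]
    refine add_nonneg ?_ (mul_nonneg (ih i) (sq_nonneg _))
    cases i with
    | zero => simp
    | succ i => rw [coeff_mul_X]; exact ih i

theorem coeff_energyPoly_eq (p : ℕ) (α : ℝ) (i : ℕ) :
    (energyPoly p α).coeff i = (-1) ^ (p + i) * (P p α).coeff (2 * i) := by
  induction p generalizing i with
  | zero =>
    cases i with
    | zero => simp [energyPoly, P]
    | succ i => simp [energyPoly, P, coeff_one]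
  | succ p ih =>
    have hP : P (p + 1) α = X ^ 2 * P p α -
        P p α * C ((2 * ((p + 1 : ℕ) : ℝ) - 1 - α) ^ 2 / 4) := by
      rw [P, Finset.prod_Icc_succ_top (by lia), ← P]
      ring
    rw [energyPoly_succ, hP, mul_add, coeff_add, coeff_mul_C, coeff_sub, coeff_mul_C, ih i]
    cases i with
    | zero =>
      simp only [coeff_mul_X_zero, mul_zero, pow_succ, add_zero]
      norm_num
      ring
    | succ i =>
      rw [coeff_mul_X, ih i, show 2 * (i + 1) = 2 * i + 2 by ring, coeff_X_pow_mul]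
      ring

theorem abs_c_eq (p : ℕ) (α : ℝ) (i : ℕ) : |c (2 * i) p α| = (energyPoly p α).coeff i := by
  rw [← abs_of_nonneg (coeff_energyPoly_nonneg p α i), coeff_energyPoly_eq, abs_mul, abs_pow,
    abs_neg, abs_one, one_pow, one_mul, c]

theorem energyPoly_eq_prod_range (p : ℕ) (α : ℝ) : energyPoly p α =
    ∏ i ∈ Finset.range p, (X + C (((2 * (p : ℝ) - 1 - α) / 2 - i) ^ 2)) := by
  rw [← Finset.prod_range_reflect, energyPoly, ← Finset.Ico_add_one_right_eq_Icc,
    Finset.prod_Ico_eq_prod_range]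
  refine Finset.prod_congr (by simp) fun i hi => ?_
  have hi' : i + 1 ≤ p := Finset.mem_range.mp (by simpa using hi)
  rw [Nat.sub_sub, add_comm 1 i, Nat.cast_sub hi']
  push_cast
  congr 3
  ring

/-- The weighted energy of `ℓ` derivatives in logarithmic variables. -/
theorem setIntegral_rpow_mul_norm_sq_iteratedDeriv {σ b : ℝ} (hσ : σ ^ 2 = 1) {S : Set ℝ}
    {g : ℝ → ℂ} (hg : IsTestFunction S g) (hS : S ⊆ Set.Ioi 0) (hSm : MeasurableSet S)
    (ℓ : ℕ) (α : ℝ) :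
    ∫ x in S, x ^ α * ‖iteratedDeriv ℓ g x‖ ^ 2 = ∑ j ∈ Finset.range (ℓ + 1),
      (energyPoly ℓ α).coeff j *
        ∫ t, ‖iteratedDeriv j (logSubst σ b ((2 * ℓ - 1 - α) / 2) g) t‖ ^ 2 := by
  have h := setIntegral_eq_setIntegral_logSubst (b := b) hσ (hg.iteratedDeriv ℓ) hS hSm
    (Set.mapsTo_univ _ _) (s := (2 * ℓ - 1 - α) / 2 - ℓ) (β := α) (by ring)
    (W := fun _ => 1) (V := fun _ => 1) (fun _ _ => rfl)
  have h' := integral_norm_sq_iteratedDeriv_logSubst (b := b) hσ hg hS ((2 * ℓ - 1 - α) / 2) ℓ 0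
  simp only [mul_one, one_mul, setIntegral_univ] at h
  simp only [zero_add, iteratedDeriv_zero] at h'
  rw [h, h', ← energyPoly_eq_prod_range,
    momentFunctional_eq_sum _ (n := ℓ + 1) (by rw [natDegree_energyPoly]; lia)]

/-! ### The induction on the number of logarithms -/

/-- The unweighted refined inequality of every order `j ≥ 1`, with `N` logarithmic terms
built from the weights `v` and without the terms of index at least `2`. -/
def HardyRefinement (S : Set ℝ) (v : ℕ → ℝ → ℝ) (N : ℕ) : Prop :=
  ∀ j : ℕ, 1 ≤ j → ∀ g : ℝ → ℂ, IsTestFunction S g →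
    A j 0 * (∫ t in S, t⁻¹ ^ (2 * j) * ‖g t‖ ^ 2) +
      B j 0 * ∑ k ∈ Finset.Icc 1 N,
        (∫ t in S, t⁻¹ ^ (2 * j) * (∏ p ∈ Finset.Icc 1 k, v p t ^ 2) * ‖g t‖ ^ 2) ≤
      ∫ t, ‖iteratedDeriv j g t‖ ^ 2 ∧
    ((∃ t, g t ≠ 0) → A j 0 * (∫ t in S, t⁻¹ ^ (2 * j) * ‖g t‖ ^ 2) +
      B j 0 * ∑ k ∈ Finset.Icc 1 N,
        (∫ t in S, t⁻¹ ^ (2 * j) * (∏ p ∈ Finset.Icc 1 k, v p t ^ 2) * ‖g t‖ ^ 2) <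
      ∫ t, ‖iteratedDeriv j g t‖ ^ 2)

theorem rpow_zero_sub_two_mul {x : ℝ} (hx : 0 < x) (j : ℕ) :
    x ^ ((0 : ℝ) - 2 * (j : ℝ)) = x⁻¹ ^ (2 * j) := by
  rw [zero_sub, Real.rpow_neg hx.le, inv_pow, ← Real.rpow_natCast]
  push_cast
  rfl

theorem setIntegral_norm_sq_iteratedDeriv {S : Set ℝ} {g : ℝ → ℂ} (hg : IsTestFunction S g)
    (n : ℕ) :
    ∫ x in S, x ^ (0 : ℝ) * ‖iteratedDeriv n g x‖ ^ 2 = ∫ x, ‖iteratedDeriv n g x‖ ^ 2 := by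
  simp only [Real.rpow_zero, one_mul]
  exact setIntegral_eq_integral_of_forall_compl_eq_zero fun x hx => by
    simp [(hg.iteratedDeriv n).eq_zero_of_notMem hx]

/-- Without logarithms, the term of index `0` of the energy already gives the bound. -/
theorem hardyRefinement_zero {S : Set ℝ} (hS : S ⊆ Set.Ioi 0) (hSm : MeasurableSet S)
    (v : ℕ → ℝ → ℝ) : HardyRefinement S v 0 := by
  intro j hj g hg
  have hE := setIntegral_rpow_mul_norm_sq_iteratedDeriv (σ := 1) (b := 0) (one_pow 2) hg hS hSm j 0
  have h0 := setIntegral_eq_setIntegral_logSubst (σ := 1) (b := 0) (one_pow 2) hg hS hSm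
    (Set.mapsTo_univ _ _) (s := (2 * j - 1 - 0) / 2) (β := 0 - 2 * j) (by ring)
    (W := fun _ => 1) (V := fun _ => 1) (fun _ _ => rfl)
  have hw : IsTestFunction Set.univ (logSubst 1 0 ((2 * j - 1 - 0) / 2) g) :=
    hg.logSubst (one_pow 2) hS (Set.mapsTo_univ _ _) _
  have hJ : ∫ t in S, t⁻¹ ^ (2 * j) * ‖g t‖ ^ 2 =
      ∫ t in S, t ^ ((0 : ℝ) - 2 * (j : ℝ)) * 1 * ‖g t‖ ^ 2 :=
    setIntegral_congr_fun hSm fun x hx => by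
      simp only [rpow_zero_sub_two_mul (hS hx), mul_one]
  rw [setIntegral_norm_sq_iteratedDeriv hg, Finset.sum_range_succ', coeff_energyPoly_zero] at hE
  simp only [one_mul, setIntegral_univ] at h0
  simp only [Finset.Icc_eq_empty_of_lt zero_lt_one, Finset.sum_empty, mul_zero, add_zero]
  rw [hE, hJ, h0]
  simp only [iteratedDeriv_zero]
  have hnn (i : ℕ) : 0 ≤ (energyPoly j 0).coeff (i + 1) *
      ∫ t, ‖iteratedDeriv (i + 1) (logSubst 1 0 ((2 * j - 1 - 0) / 2) g) t‖ ^ 2 :=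
    mul_nonneg (coeff_energyPoly_nonneg _ _ _) (integral_nonneg fun _ => by positivity)
  refine ⟨le_add_of_nonneg_left (Finset.sum_nonneg fun i _ => hnn i), fun hne =>
    lt_add_of_pos_left _ (Finset.sum_pos' (fun i _ => hnn i) ⟨j - 1, by simp; lia, ?_⟩)⟩
  -- the top coefficient is `1`
  rw [Nat.sub_add_cancel hj, coeff_energyPoly_self, one_mul]
  exact (hw.iteratedDeriv j).integral_norm_sq_pos (hw.exists_iteratedDeriv_ne_zero
    (exists_logSubst_ne_zero (one_pow 2) hg hS hne _) j)

theorem sum_Icc_one_succ {M : Type*} [AddCommMonoid M] (F : ℕ → M) (n : ℕ) :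
    ∑ k ∈ Finset.Icc 1 (n + 1), F k = F 1 + ∑ k ∈ Finset.Icc 1 n, F (k + 1) := by
  induction n with
  | zero => simp
  | succ n ih => rw [Finset.sum_Icc_succ_top (by lia), ih, Finset.sum_Icc_succ_top (by lia),
      add_assoc]

theorem prod_Icc_one_succ {M : Type*} [CommMonoid M] (F : ℕ → M) (n : ℕ) :
    ∏ k ∈ Finset.Icc 1 (n + 1), F k = F 1 * ∏ k ∈ Finset.Icc 1 n, F (k + 1) :=
  sum_Icc_one_succ (M := Additive M) F n

theorem sum_range_succ_eq_sum_Icc {M : Type*} [AddCommMonoid M] (F : ℕ → M) (n : ℕ) :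
    ∑ k ∈ Finset.range (n + 1), F k = F 0 + ∑ k ∈ Finset.Icc 1 n, F k := by
  induction n with
  | zero => simp
  | succ n ih => rw [Finset.sum_range_succ, ih, Finset.sum_Icc_succ_top (by lia), add_assoc]

/-- The term `j = 1` of the bound for the energy produces the terms with the factor `B ℓ α`, the
terms `j ≥ 2` produce the two remaining sums. -/
theorem logTerms_eq {σ b : ℝ} (hσ : σ ^ 2 = 1) {S T : Set ℝ} (hS : S ⊆ Set.Ioi 0)
    (hSm : MeasurableSet S) (hT : Set.MapsTo (logCoord σ b) S T) {u v : ℕ → ℝ → ℝ}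
    (hv : ∀ t, v 0 t = t⁻¹) (hu : ∀ p, ∀ x ∈ S, u (p + 1) x = v p (logCoord σ b x))
    {ℓ : ℕ} (hℓ : 1 ≤ ℓ) (m N : ℕ) (α : ℝ) {f : ℝ → ℂ} (hf : IsTestFunction S f) :
    logTerms S u ℓ m (N + 1) α f = ∑ j ∈ Finset.Icc 1 ℓ, (energyPoly ℓ α).coeff j *
      (A j 0 * (∫ t in T, t⁻¹ ^ (2 * j) *
          ‖logSubst σ b ((2 * ℓ - 1 - α) / 2) (iteratedDeriv (m - ℓ) f) t‖ ^ 2) +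
        B j 0 * ∑ k ∈ Finset.Icc 1 N, (∫ t in T, t⁻¹ ^ (2 * j) *
          (∏ p ∈ Finset.Icc 1 k, v p t ^ 2) *
          ‖logSubst σ b ((2 * ℓ - 1 - α) / 2) (iteratedDeriv (m - ℓ) f) t‖ ^ 2)) := by
  have hg := hf.iteratedDeriv (m - ℓ)
  set g := iteratedDeriv (m - ℓ) f with hgdef
  have hu1 (x : ℝ) (hx : x ∈ S) : u 1 x = (logCoord σ b x)⁻¹ := by
    rw [← hv]; exact hu 0 x hx
  have key {W V : ℝ → ℝ} (hW : ∀ x ∈ S, W x = V (logCoord σ b x)) :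
      ∫ x in S, x ^ (α - 2 * (ℓ : ℝ)) * W x * ‖g x‖ ^ 2 =
        ∫ t in T, V t * ‖logSubst σ b ((2 * ℓ - 1 - α) / 2) g t‖ ^ 2 :=
    setIntegral_eq_setIntegral_logSubst hσ hg hS hSm hT (by ring) hW
  have h1 : ∫ x in S, x ^ (α - 2 * (ℓ : ℝ)) * (∏ p ∈ Finset.Icc 1 1, u p x ^ 2) * ‖g x‖ ^ 2 =
      ∫ t in T, t⁻¹ ^ (2 * 1) * ‖logSubst σ b ((2 * ℓ - 1 - α) / 2) g t‖ ^ 2 :=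
    key (V := fun t => t⁻¹ ^ (2 * 1)) fun x hx => by simp [hu1 x hx]
  have h2 (k : ℕ) : ∫ x in S, x ^ (α - 2 * (ℓ : ℝ)) *
        (∏ p ∈ Finset.Icc 1 (k + 1), u p x ^ 2) * ‖g x‖ ^ 2 =
      ∫ t in T, t⁻¹ ^ (2 * 1) * (∏ p ∈ Finset.Icc 1 k, v p t ^ 2) *
        ‖logSubst σ b ((2 * ℓ - 1 - α) / 2) g t‖ ^ 2 :=
    key (V := fun t => t⁻¹ ^ (2 * 1) * ∏ p ∈ Finset.Icc 1 k, v p t ^ 2) fun x hx => by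
      rw [prod_Icc_one_succ, hu1 x hx, mul_one]
      simp only [hu _ x hx]
  have h3 (j : ℕ) : ∫ x in S, x ^ (α - 2 * (ℓ : ℝ)) * u 1 x ^ (2 * j) * ‖g x‖ ^ 2 =
      ∫ t in T, t⁻¹ ^ (2 * j) * ‖logSubst σ b ((2 * ℓ - 1 - α) / 2) g t‖ ^ 2 :=
    key (V := fun t => t⁻¹ ^ (2 * j)) fun x hx => by rw [hu1 x hx]
  have h4 (j k : ℕ) : ∫ x in S, x ^ (α - 2 * (ℓ : ℝ)) * u 1 x ^ (2 * j) *
        (∏ p ∈ Finset.Icc 1 k, u (p + 1) x ^ 2) * ‖g x‖ ^ 2 =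
      ∫ t in T, t⁻¹ ^ (2 * j) * (∏ p ∈ Finset.Icc 1 k, v p t ^ 2) *
        ‖logSubst σ b ((2 * ℓ - 1 - α) / 2) g t‖ ^ 2 := by
    simp only [mul_assoc (_ ^ (α - 2 * (ℓ : ℝ))) (_ ^ (2 * j))]
    exact key (V := fun t => t⁻¹ ^ (2 * j) * ∏ p ∈ Finset.Icc 1 k, v p t ^ 2) fun x hx => by
      rw [hu1 x hx]
      simp only [hu _ x hx]
  rw [logTerms, ← hgdef, sum_Icc_one_succ, h1]
  simp only [h2, h3, h4, abs_c_eq, Nat.add_sub_cancel]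
  rw [← Finset.insert_Icc_add_one_left_eq_Icc hℓ, Finset.sum_insert (by simp),
    coeff_energyPoly_one, show A 1 0 = 1 / 4 by norm_num [A], show B 1 0 = 1 / 4 by simp [B],
    add_assoc, ← Finset.sum_add_distrib]
  congr 1
  · ring
  · exact Finset.sum_congr rfl fun j _ => by ring

/-- One logarithmic substitution trades a refinement with `N` logarithms on `T` for one with
`N + 1` logarithms on `S`. -/
theorem HardyRefinement.refinedInequality {σ b : ℝ} (hσ : σ ^ 2 = 1) {S T : Set ℝ}
    (hS : S ⊆ Set.Ioi 0) (hSm : MeasurableSet S) (hT : Set.MapsTo (logCoord σ b) S T)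
    {u v : ℕ → ℝ → ℝ} (hv : ∀ t, v 0 t = t⁻¹)
    (hu : ∀ p, ∀ x ∈ S, u (p + 1) x = v p (logCoord σ b x)) {N : ℕ}
    (H : HardyRefinement T v N) {ℓ m : ℕ} (hℓ : 1 ≤ ℓ) (hm : ℓ ≤ m) (α : ℝ) :
    RefinedInequality S u ℓ m (N + 1) α := by
  intro f hf
  have hg := hf.iteratedDeriv (m - ℓ)
  have hw := hg.logSubst hσ hS hT ((2 * ℓ - 1 - α) / 2)
  have hmℓ : iteratedDeriv m f = iteratedDeriv ℓ (iteratedDeriv (m - ℓ) f) := by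
    rw [iteratedDeriv_eq_iterate, iteratedDeriv_eq_iterate, iteratedDeriv_eq_iterate,
      ← Function.iterate_add_apply, Nat.add_sub_cancel' hm]
  have h0 : powerIntegral S (α - 2 * (ℓ : ℝ)) (m - ℓ) f =
      ∫ t, ‖logSubst σ b ((2 * ℓ - 1 - α) / 2) (iteratedDeriv (m - ℓ) f) t‖ ^ 2 := by
    have h := setIntegral_eq_setIntegral_logSubst (b := b) hσ hg hS hSm
      (Set.mapsTo_univ _ _) (s := (2 * ℓ - 1 - α) / 2) (β := α - 2 * ℓ) (by ring)
      (W := fun _ => 1) (V := fun _ => 1) (fun _ _ => rfl)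
    simpa only [mul_one, one_mul, setIntegral_univ] using! h
  have hE := setIntegral_rpow_mul_norm_sq_iteratedDeriv (b := b) hσ hg hS hSm ℓ α
  rw [← hmℓ] at hE
  change powerIntegral S α m f = _ at hE
  rw [hE, sum_range_succ_eq_sum_Icc, coeff_energyPoly_zero, iteratedDeriv_zero, h0,
    logTerms_eq hσ hS hSm hT hv hu hℓ m N α hf]
  have hle (j : ℕ) (hj : j ∈ Finset.Icc 1 ℓ) := mul_le_mul_of_nonneg_left
    (H j (Finset.mem_Icc.mp hj).1 _ hw).1 (coeff_energyPoly_nonneg ℓ α j)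
  refine ⟨add_le_add_right (Finset.sum_le_sum hle) _, fun ⟨x, _, hx⟩ => ?_⟩
  -- strictness comes from the highest order term, whose coefficient is `1`
  refine add_lt_add_right (Finset.sum_lt_sum hle ⟨ℓ, Finset.mem_Icc.mpr ⟨hℓ, le_rfl⟩, ?_⟩) _
  rw [coeff_energyPoly_self, one_mul, one_mul]
  exact (H ℓ hℓ _ hw).2 (exists_logSubst_ne_zero hσ hg hS
    (hf.exists_iteratedDeriv_ne_zero ⟨x, hx⟩ _) _)

theorem B_mul_sum_le_logTerms {S : Set ℝ} (hS : S ⊆ Set.Ioi 0) (hSm : MeasurableSet S)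
    (u : ℕ → ℝ → ℝ) (ℓ m N : ℕ) (α : ℝ) (f : ℝ → ℂ) (hu : ∀ x ∈ S, 0 ≤ u 1 x) :
    B ℓ α * ∑ k ∈ Finset.Icc 1 N,
      (∫ x in S, x ^ (α - 2 * (ℓ : ℝ)) * (∏ p ∈ Finset.Icc 1 k, u p x ^ 2)
        * ‖iteratedDeriv (m - ℓ) f x‖ ^ 2) ≤ logTerms S u ℓ m N α f := by
  rw [logTerms, add_assoc]
  have hx (x : ℝ) (hx : x ∈ S) : 0 ≤ x ^ (α - 2 * (ℓ : ℝ)) := Real.rpow_nonneg (hS hx).le _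
  refine le_add_of_nonneg_right (add_nonneg (Finset.sum_nonneg fun j _ => ?_)
    (Finset.sum_nonneg fun j _ => ?_))
  · refine mul_nonneg (mul_nonneg (abs_nonneg _) (A_nonneg _ _)) (setIntegral_nonneg hSm
      fun x hxS => ?_)
    have := hx x hxS
    have := hu x hxS
    positivity
  · refine mul_nonneg (mul_nonneg (abs_nonneg _) (B_nonneg _ _)) (Finset.sum_nonneg fun k _ =>
      setIntegral_nonneg hSm fun x hxS => ?_)
    have := hx x hxS
    have := hu x hxS
    have : 0 ≤ ∏ p ∈ Finset.Icc 1 k, u (p + 1) x ^ 2 := Finset.prod_nonneg fun _ _ => sq_nonneg _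
    positivity

/-- The terms of index at least `2` are nonnegative and are dropped. -/
theorem hardyRefinement_of_refinedInequality {S : Set ℝ} (hS : S ⊆ Set.Ioi 0)
    (hSm : MeasurableSet S) {u : ℕ → ℝ → ℝ} (hu : ∀ x ∈ S, 0 ≤ u 1 x) {N : ℕ}
    (H : ∀ j, 1 ≤ j → RefinedInequality S u j j N 0) : HardyRefinement S u N := by
  intro j hj g hg
  obtain ⟨h1, h2⟩ := H j hj g hg
  have hlog := B_mul_sum_le_logTerms hS hSm u j j N 0 g hu
  rw [powerIntegral, setIntegral_norm_sq_iteratedDeriv hg, powerIntegral] at h1 h2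
  have e1 : ∫ x in S, x ^ ((0 : ℝ) - 2 * (j : ℝ)) * ‖iteratedDeriv (j - j) g x‖ ^ 2 =
      ∫ t in S, t⁻¹ ^ (2 * j) * ‖g t‖ ^ 2 :=
    setIntegral_congr_fun hSm fun x hx => by
      simp only [rpow_zero_sub_two_mul (hS hx), Nat.sub_self, iteratedDeriv_zero]
  have e2 (k : ℕ) : ∫ x in S, x ^ ((0 : ℝ) - 2 * (j : ℝ)) * (∏ p ∈ Finset.Icc 1 k, u p x ^ 2) *
        ‖iteratedDeriv (j - j) g x‖ ^ 2 =
      ∫ t in S, t⁻¹ ^ (2 * j) * (∏ p ∈ Finset.Icc 1 k, u p t ^ 2) * ‖g t‖ ^ 2 :=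
    setIntegral_congr_fun hSm fun x hx => by
      simp only [rpow_zero_sub_two_mul (hS hx), Nat.sub_self, iteratedDeriv_zero]
  rw [e1] at h1 h2
  simp only [e2] at hlog
  refine ⟨by linarith, fun ⟨x, hx⟩ => ?_⟩
  have := h2 ⟨x, by_contra fun hn => hx (hg.eq_zero_of_notMem hn), hx⟩
  linarith

/-! ### Iterated and normalized logarithms -/

theorem iterLog_succ' (p : ℕ) (x : ℝ) : iterLog (p + 1) x = iterLog p (Real.log x) := by
  induction p with
  | zero => rfl
  | succ p ih => rw [iterLog, ih, iterLog]

theorem normLog_succ' (p : ℕ) (s : ℝ) : normLog (p + 1) s = normLog p (1 - Real.log s)⁻¹ := by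
  induction p with
  | zero => rfl
  | succ p ih => rw [normLog, ih, normLog]

theorem iterExp_nonneg (N : ℕ) : 0 ≤ iterExp N := by
  cases N with
  | zero => exact le_rfl
  | succ N => exact (Real.exp_pos _).le

theorem log_mem_Ioi_iterExp {N : ℕ} {x : ℝ} (hx : iterExp (N + 1) < x) :
    iterExp N < Real.log x :=
  (Real.lt_log_iff_exp_lt ((iterExp_nonneg _).trans_lt hx)).mpr hx

theorem hardyRefinement_iterLog (N : ℕ) :
    HardyRefinement (Set.Ioi (iterExp N)) (fun p t => (iterLog p t)⁻¹) N := by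
  induction N with
  | zero => exact hardyRefinement_zero le_rfl measurableSet_Ioi _
  | succ N ih =>
    have hS : Set.Ioi (iterExp (N + 1)) ⊆ Set.Ioi 0 := Set.Ioi_subset_Ioi (iterExp_nonneg _)
    refine hardyRefinement_of_refinedInequality hS measurableSet_Ioi (fun x hx => ?_)
      fun j hj => ih.refinedInequality (σ := 1) (b := 0) (one_pow 2) hS measurableSet_Ioi
        (fun x hx => ?_) (fun _ => rfl) (fun p x _ => ?_) hj le_rfl 0
    · exact inv_nonneg.mpr ((iterExp_nonneg N).trans (log_mem_Ioi_iterExp hx).le)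
    · simpa [logCoord] using log_mem_Ioi_iterExp hx
    · simp [logCoord, iterLog_succ']

theorem hardyRefinement_normLog (N : ℕ) :
    HardyRefinement (Set.Ioi 1) (fun p t => normLog p t⁻¹) N := by
  have hS : Set.Ioi (1 : ℝ) ⊆ Set.Ioi 0 := Set.Ioi_subset_Ioi zero_le_one
  induction N with
  | zero => exact hardyRefinement_zero hS measurableSet_Ioi _
  | succ N ih =>
    refine hardyRefinement_of_refinedInequality hS measurableSet_Ioi (fun x hx => ?_)
      fun j hj => ih.refinedInequality (σ := 1) (b := -1) (one_pow 2) hS measurableSet_Ioi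
        (fun x hx => ?_) (fun _ => rfl) (fun p x _ => ?_) hj le_rfl 0
    · have := Real.log_pos hx
      simp only [normLog, Real.log_inv, sub_neg_eq_add]
      positivity
    · simpa [logCoord] using Real.log_pos hx
    · simp [logCoord, normLog_succ', add_comm]

section

variable {ℓ m N : ℕ} {α ρ γ τ : ℝ}

theorem refinedInequality_iterLog_exterior (hℓ : 1 ≤ ℓ) (hℓm : ℓ ≤ m) (hN : 1 ≤ N) (hρ : 0 < ρ)
    (hγ : 0 < γ) (h : iterExp N * γ ≤ ρ) :
    RefinedInequality (Set.Ioi ρ) (fun p x => (iterLog p (x / γ))⁻¹) ℓ m N α := by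
  obtain ⟨N, rfl⟩ := Nat.exists_eq_add_of_le' hN
  have hlog (x : ℝ) (hx : x ∈ Set.Ioi ρ) : logCoord 1 (Real.log γ) x = Real.log (x / γ) := by
    rw [logCoord, one_mul, Real.log_div (hρ.trans hx).ne' hγ.ne']
  refine (hardyRefinement_iterLog N).refinedInequality (σ := 1) (b := Real.log γ) (one_pow 2)
    (Set.Ioi_subset_Ioi hρ.le) measurableSet_Ioi (fun x hx => ?_) (fun _ => rfl)
    (fun p x hx => ?_) hℓ hℓm α
  · rw [hlog x hx]
    exact log_mem_Ioi_iterExp ((lt_div_iff₀ hγ).mpr (h.trans_lt hx))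
  · simp only [hlog x hx, iterLog_succ']

theorem refinedInequality_normLog_exterior (hℓ : 1 ≤ ℓ) (hℓm : ℓ ≤ m) (hN : 1 ≤ N) (hρ : 0 < ρ)
    (hτ : 0 < τ) (h : τ ≤ ρ) :
    RefinedInequality (Set.Ioi ρ) (fun p x => normLog p (τ / x)) ℓ m N α := by
  obtain ⟨N, rfl⟩ := Nat.exists_eq_add_of_le' hN
  have hlog (x : ℝ) (hx : x ∈ Set.Ioi ρ) :
      logCoord 1 (Real.log τ - 1) x = 1 - Real.log (τ / x) := by
    rw [logCoord, one_mul, Real.log_div hτ.ne' (hρ.trans hx).ne']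
    ring
  refine (hardyRefinement_normLog N).refinedInequality (σ := 1) (b := Real.log τ - 1) (one_pow 2)
    (Set.Ioi_subset_Ioi hρ.le) measurableSet_Ioi (fun x hx => ?_) (fun _ => rfl)
    (fun p x hx => ?_) hℓ hℓm α
  · have hx0 : 0 < x := hρ.trans hx
    have := Real.log_neg (div_pos hτ hx0) ((div_lt_one hx0).mpr (h.trans_lt hx))
    rw [hlog x hx, Set.mem_Ioi]
    linarith
  · simp only [hlog x hx, normLog_succ']

theorem refinedInequality_iterLog_interior (hℓ : 1 ≤ ℓ) (hℓm : ℓ ≤ m) (hN : 1 ≤ N)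
    (hγ : 0 < γ) (h : iterExp N * ρ ≤ γ) :
    RefinedInequality (Set.Ioo 0 ρ) (fun p x => (iterLog p (γ / x))⁻¹) ℓ m N α := by
  obtain ⟨N, rfl⟩ := Nat.exists_eq_add_of_le' hN
  have hlog (x : ℝ) (hx : x ∈ Set.Ioo 0 ρ) : logCoord (-1) (Real.log γ) x = Real.log (γ / x) := by
    rw [logCoord, Real.log_div hγ.ne' hx.1.ne']
    ring
  refine (hardyRefinement_iterLog N).refinedInequality (σ := -1) (b := Real.log γ) (by norm_num)
    (fun x hx => hx.1) measurableSet_Ioo (fun x hx => ?_) (fun _ => rfl)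
    (fun p x hx => ?_) hℓ hℓm α
  · rw [hlog x hx]
    exact log_mem_Ioi_iterExp ((lt_div_iff₀ hx.1).mpr
      ((mul_lt_mul_of_pos_left hx.2 (Real.exp_pos _)).trans_le h))
  · simp only [hlog x hx, iterLog_succ']

theorem refinedInequality_normLog_interior (hℓ : 1 ≤ ℓ) (hℓm : ℓ ≤ m) (hN : 1 ≤ N)
    (hτ : 0 < τ) (h : ρ ≤ τ) :
    RefinedInequality (Set.Ioo 0 ρ) (fun p x => normLog p (x / τ)) ℓ m N α := by
  obtain ⟨N, rfl⟩ := Nat.exists_eq_add_of_le' hN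
  have hlog (x : ℝ) (hx : x ∈ Set.Ioo 0 ρ) :
      logCoord (-1) (Real.log τ + 1) x = 1 - Real.log (x / τ) := by
    rw [logCoord, Real.log_div hx.1.ne' hτ.ne']
    ring
  refine (hardyRefinement_normLog N).refinedInequality (σ := -1) (b := Real.log τ + 1)
    (by norm_num) (fun x hx => hx.1) measurableSet_Ioo (fun x hx => ?_) (fun _ => rfl)
    (fun p x hx => ?_) hℓ hℓm α
  · have := Real.log_neg (div_pos hx.1 hτ) ((div_lt_one hτ).mpr (hx.2.trans_le h))
    rw [hlog x hx, Set.mem_Ioi]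
    linarith
  · simp only [hlog x hx, normLog_succ']

theorem RefinedInequality.withoutA {S : Set ℝ} {u : ℕ → ℝ → ℝ}
    (H : RefinedInequality S u ℓ m N α) (hA : A ℓ α = 0) :
    RefinedInequalityWithoutA S u ℓ m N α := fun f hf => by
  simpa [hA] using H f hf

end

end BHR

theorem theorem3p1 (ℓ m N : ℕ) (hℓ : 1 ≤ ℓ) (hℓm : ℓ ≤ m) (hN : 1 ≤ N)
    (α ρ γ τ : ℝ) (hρ : 0 < ρ) (hγ : 0 < γ) (hτ : 0 < τ) :
    -- exterior interval, iterated logarithms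
    (BHR.iterExp N * γ ≤ ρ →
      BHR.RefinedInequality (Set.Ioi ρ) (fun p x => (BHR.iterLog p (x / γ))⁻¹) ℓ m N α) ∧
    -- exterior interval, normalized logarithms
    (τ ≤ ρ →
      BHR.RefinedInequality (Set.Ioi ρ) (fun p x => BHR.normLog p (τ / x)) ℓ m N α) ∧
    -- interior interval, iterated logarithms
    (BHR.iterExp N * ρ ≤ γ →
      BHR.RefinedInequality (Set.Ioo 0 ρ) (fun p x => (BHR.iterLog p (γ / x))⁻¹) ℓ m N α) ∧
    -- interior interval, normalized logarithms
    (ρ ≤ τ →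
      BHR.RefinedInequality (Set.Ioo 0 ρ) (fun p x => BHR.normLog p (x / τ)) ℓ m N α) ∧
    -- the exceptional cases: exactly those with `A(ℓ,α) = 0`, and there the first term is deleted
    (BHR.A ℓ α = 0 ↔ ∃ j ∈ Finset.Icc 1 ℓ, α = 2 * (j : ℝ) - 1) ∧
    ((∃ j ∈ Finset.Icc 1 ℓ, α = 2 * (j : ℝ) - 1) →
      (BHR.iterExp N * γ ≤ ρ →
        BHR.RefinedInequalityWithoutA (Set.Ioi ρ)
          (fun p x => (BHR.iterLog p (x / γ))⁻¹) ℓ m N α) ∧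
      (τ ≤ ρ →
        BHR.RefinedInequalityWithoutA (Set.Ioi ρ)
          (fun p x => BHR.normLog p (τ / x)) ℓ m N α) ∧
      (BHR.iterExp N * ρ ≤ γ →
        BHR.RefinedInequalityWithoutA (Set.Ioo 0 ρ)
          (fun p x => (BHR.iterLog p (γ / x))⁻¹) ℓ m N α) ∧
      (ρ ≤ τ →
        BHR.RefinedInequalityWithoutA (Set.Ioo 0 ρ)
          (fun p x => BHR.normLog p (x / τ)) ℓ m N α)) := by
  have h₁ := fun h => BHR.refinedInequality_iterLog_exterior (α := α) hℓ hℓm hN hρ hγ h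
  have h₂ := fun h => BHR.refinedInequality_normLog_exterior (α := α) hℓ hℓm hN hρ hτ h
  have h₃ := fun h => BHR.refinedInequality_iterLog_interior (ρ := ρ) (α := α) hℓ hℓm hN hγ h
  have h₄ := fun h => BHR.refinedInequality_normLog_interior (ρ := ρ) (α := α) hℓ hℓm hN hτ h
  refine ⟨h₁, h₂, h₃, h₄, BHR.A_eq_zero_iff, fun hα => ?_⟩
  have hA := BHR.A_eq_zero_iff.mpr hα
  exact ⟨fun h => (h₁ h).withoutA hA, fun h => (h₂ h).withoutA hA, fun h => (h₃ h).withoutA hA,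
    fun h => (h₄ h).withoutA hA⟩
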